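/- Let $\mathbf{k}$ be a field of characteristic $0$, let $\mathfrak{f}_2=\mathfrak{f}_2(A,B)$ be the free Lie algebra over $\mathbf{k}$ on $A,B$, graded by $\deg A=\deg B=1$, let $\mathfrak{p}=[\mathfrak{f}_2,\mathfrak{f}_2]$, and let $i:\mathfrak{p}/[\mathfrak{p},\mathfrak{p}]\to(\bar A\bar B)\subset\mathbf{k}[\bar A,\bar B]$ be the linear isomorphism onto the ideal $(\bar A\bar B)$ that sends the class of $\mathrm{ad}(A)^{a-1}\mathrm{ad}(B)^{b-1}([A,B])$ to $\bar A^{a}\bar B^{b}$ for $a,b\ge 1$. For $m\ge2$ let $\mathfrak{t}_m$ be the Lie algebra with generators $t_{ij}$ ($1\le i\ne j\le m$) and relations $t_{ij}=t_{ji}$, $[t_{ij}+t_{il},t_{jl}]=0$ for distinct $i,j,l$, and $[t_{ij},t_{lp}]=0$ for distinct $i,j,l,p$. For pairwise disjoint $I_1,I_2,I_3\subset\{1,2,3,4\}$ let $\psi\mapsto\psi^{I_1,I_2,I_3}$ be the Lie algebra morphism $\mathfrak{t}_3\to\mathfrak{t}_4$, $t_{ij}\mapsto\sum_{\alpha\in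 I_i,\beta\in I_j}t_{\alpha\beta}$, applied to elements of $\mathfrak{f}_2$ through $A=t_{12}$, $B=t_{23}$. The Lie algebra $\mathfrak{grt}_1(\mathbf{k})$ is the set of $\psi\in\mathfrak{f}_2$ that satisfy the duality relation $\psi(B,A)=-\psi(A,B)$, the hexagon relation $\psi(A,B)+\psi(B,C)+\psi(C,A)=0$ with $C=-A-B$, and the pentagon relation $\psi^{12,3,4}-\psi^{1,23,4}+\psi^{1,2,34}=\psi^{2,3,4}+\psi^{1,2,3}$ in $\mathfrak{t}_4$. Theorem. Let $n\ge 0$ and let $\psi\in\mathfrak{f}_2$ be homogeneous of degree $n$ and satisfy the hexagon and pentagon relations (in particular, $\psi$ may be any element of $\mathfrak{grt}_1(\mathbf{k})$ that is homogeneous of degree $n$). Then $\psi\in\mathfrak{p}$; let $[\psi]$ be its class in $\mathfrak{p}/[\mathfrak{p},\mathfrak{p}]$. (a) If $n$ is odd and $n\ge3$, there is $c\in\mathbf{k}$ such that $i([\psi])=c\,\big((\bar A+\bar B)^n-\bar A^n-\bar B^n\big)$. Moreover $[\psi]=c\,[\sigma_n]$ for every Drinfeld generator $\sigma_n$, that is,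 for every $\sigma_n\in\mathfrak{grt}_1(\mathbf{k})\cap\mathfrak{p}$ with $i([\sigma_n])=(\bar A+\bar B)^n-\bar A^n-\bar B^n$. (b) Otherwise $[\psi]=0$. -/

import Mathlib

/-! ## The free Lie algebra on two generators and its grading -/

/-- The free Lie algebra `𝔣₂(A, B)`; the generators are indexed by `Fin 2`. -/
abbrev F2 (k : Type*) [Field k] : Type _ := FreeLieAlgebra k (Fin 2)

namespace F2

variable (k : Type*) [Field k]

/-- The free generator `A`. -/
noncomputable def A : F2 k := FreeLieAlgebra.of k 0

/-- The free generator `B`. -/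
noncomputable def B : F2 k := FreeLieAlgebra.of k 1

variable {k}

/-- Substitution `ψ ↦ ψ(x, y)`: the Lie algebra morphism with `A ↦ x`, `B ↦ y`. -/
noncomputable def subst {L : Type*} [LieRing L] [LieAlgebra k L] (x y : L) : F2 k →ₗ⁅k⁆ L :=
  FreeLieAlgebra.lift k ![x, y]

/-- `IsLieWord n w`: `w` is an iterated bracket of `n` letters from `{A, B}`. -/
inductive IsLieWord : ℕ → F2 k → Prop
  | of (x : Fin 2) : IsLieWord 1 (FreeLieAlgebra.of k x)
  | lie {m n : ℕ} {u v : F2 k} : IsLieWord m u → IsLieWord n v → IsLieWord (m + n) ⁅u, v⁆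

variable (k) in
/-- The component of degree `n` of `𝔣₂(A, B)`, where `A` and `B` have degree `1`. -/
noncomputable def homogeneous (n : ℕ) : Submodule k (F2 k) := Submodule.span k {w | IsLieWord n w}

end F2

/-! ## The Lie algebras `𝔱ₙ` and the morphisms `d^{I₁, …, Iₙ}`

Indices run over `Fin n`, so the strand `i` of the usual notation is `i - 1` here. -/

namespace DK

variable (k : Type*) [Field k]

/-- Indices of the generators `t_{ij}`, `i ≠ j`. -/
abbrev Gen (n : ℕ) : Type := {p : Fin n × Fin n // p.1 ≠ p.2}

/-- The free generator `t_{ij}` for `i ≠ j` (and `0` for `i = j`, which is never used in the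
relations). -/
noncomputable def gen {n : ℕ} (i j : Fin n) : FreeLieAlgebra k (Gen n) :=
  if h : i ≠ j then FreeLieAlgebra.of k ⟨(i, j), h⟩ else 0

/-- The elements that are set equal to zero in `𝔱ₙ`. -/
inductive Relator (n : ℕ) : FreeLieAlgebra k (Gen n) → Prop
  | symm (i j : Fin n) (hij : i ≠ j) : Relator n (gen k i j - gen k j i)
  | three (i j l : Fin n) (hij : i ≠ j) (hil : i ≠ l) (hjl : j ≠ l) :
      Relator n ⁅gen k i j + gen k i l, gen k j l⁆
  | four (i j l m : Fin n) (hij : i ≠ j) (hil : i ≠ l) (him : i ≠ m) (hjl : j ≠ l)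
      (hjm : j ≠ m) (hlm : l ≠ m) : Relator n ⁅gen k i j, gen k l m⁆

/-- The ideal generated by the defining relations of `𝔱ₙ`. -/
noncomputable def relIdeal (n : ℕ) : LieIdeal k (FreeLieAlgebra k (Gen n)) :=
  LieSubmodule.lieSpan k _ {x | Relator k n x}

/-- The Lie algebra `𝔱ₙ`. -/
abbrev T (n : ℕ) : Type _ := FreeLieAlgebra k (Gen n) ⧸ relIdeal k n

/-- The quotient morphism onto `𝔱ₙ`. -/
noncomputable def proj (n : ℕ) : FreeLieAlgebra k (Gen n) →ₗ⁅k⁆ T k n where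
  toLinearMap := (relIdeal k n).toSubmodule.mkQ
  map_lie' := rfl

/-- The generator `t_{ij}` of `𝔱ₙ` (`0` if `i = j`). -/
noncomputable def t {n : ℕ} (i j : Fin n) : T k n := proj k n (gen k i j)

variable {k}

theorem proj_relator {n : ℕ} {x : FreeLieAlgebra k (Gen n)} (h : Relator k n x) :
    proj k n x = 0 :=
  (Submodule.Quotient.mk_eq_zero _).2 (LieSubmodule.subset_lieSpan h)

theorem t_symm {n : ℕ} (i j : Fin n) : t k i j = t k j i := by
  by_cases h : i = j
  · rw [h]
  · have := proj_relator (Relator.symm (k := k) i j h)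
    rw [map_sub, sub_eq_zero] at this
    exact this

theorem t_three {n : ℕ} {i j l : Fin n} (hij : i ≠ j) (hil : i ≠ l) (hjl : j ≠ l) :
    ⁅t k i j, t k j l⁆ + ⁅t k i l, t k j l⁆ = 0 := by
  have := proj_relator (Relator.three (k := k) i j l hij hil hjl)
  rwa [LieHom.map_lie, map_add, add_lie] at this

theorem t_four {n : ℕ} {i j l m : Fin n} (hij : i ≠ j) (hil : i ≠ l) (him : i ≠ m)
    (hjl : j ≠ l) (hjm : j ≠ m) (hlm : l ≠ m) : ⁅t k i j, t k l m⁆ = 0 := by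
  have := proj_relator (Relator.four (k := k) i j l m hij hil him hjl hjm hlm)
  rwa [LieHom.map_lie] at this

variable (k) in
/-- `∑_{α ∈ I, β ∈ J} t_{αβ}`. -/
noncomputable def tSum {m : ℕ} (I J : Finset (Fin m)) : T k m := ∑ a ∈ I, ∑ b ∈ J, t k a b

theorem tSum_symm {m : ℕ} (I J : Finset (Fin m)) : tSum k I J = tSum k J I := by
  unfold tSum
  rw [Finset.sum_comm]
  exact Finset.sum_congr rfl fun _ _ => Finset.sum_congr rfl fun _ _ => t_symm _ _

theorem tSum_three {m : ℕ} {I J K : Finset (Fin m)} (hIJ : Disjoint I J) (hIK : Disjoint I K)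
    (hJK : Disjoint J K) : ⁅tSum k I J + tSum k I K, tSum k J K⁆ = 0 := by
  have key : ∀ b ∈ J, ∀ c ∈ K, ⁅tSum k I J + tSum k I K, t k b c⁆ = 0 := by
    intro b hb c hc
    unfold tSum
    rw [← Finset.sum_add_distrib, sum_lie]
    refine Finset.sum_eq_zero fun a ha => ?_
    have hab := Finset.disjoint_left.1 hIJ ha
    have hac := Finset.disjoint_left.1 hIK ha
    have nab : a ≠ b := fun h => hab (h ▸ hb)
    have nac : a ≠ c := fun h => hac (h ▸ hc)
    have nbc : b ≠ c := fun h => Finset.disjoint_left.1 hJK hb (h ▸ hc)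
    rw [add_lie, sum_lie, sum_lie,
      Finset.sum_eq_single b, Finset.sum_eq_single c]
    · exact t_three nab nac nbc
    · intro c' hc' hne
      have nac' : a ≠ c' := fun h => hac (h ▸ hc')
      have nbc' : b ≠ c' := fun h => Finset.disjoint_left.1 hJK hb (h ▸ hc')
      exact t_four nac' nab nac nbc'.symm hne nbc
    · exact fun h => absurd hc h
    · intro b' hb' hne
      have nab' : a ≠ b' := fun h => hab (h ▸ hb')
      have ncb' : b' ≠ c := fun h => Finset.disjoint_left.1 hJK hb' (h ▸ hc)
      exact t_four nab' nab nac hne ncb' nbc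
    · exact fun h => absurd hb h
  conv_lhs => arg 2; unfold tSum
  rw [lie_sum]
  refine Finset.sum_eq_zero fun b hb => ?_
  rw [lie_sum]
  exact Finset.sum_eq_zero fun c hc => key b hb c hc

theorem tSum_four {m : ℕ} {I J K M : Finset (Fin m)} (hIJ : Disjoint I J) (hIK : Disjoint I K)
    (hIM : Disjoint I M) (hJK : Disjoint J K) (hJM : Disjoint J M) (hKM : Disjoint K M) :
    ⁅tSum k I J, tSum k K M⁆ = 0 := by
  have ne : ∀ {S S' : Finset (Fin m)}, Disjoint S S' → ∀ {a b}, a ∈ S → b ∈ S' → a ≠ b :=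
    fun h _ _ ha hb e => Finset.disjoint_left.1 h ha (e ▸ hb)
  unfold tSum
  rw [sum_lie]
  refine Finset.sum_eq_zero fun a ha => ?_
  rw [sum_lie]
  refine Finset.sum_eq_zero fun b hb => ?_
  rw [lie_sum]
  refine Finset.sum_eq_zero fun c hc => ?_
  rw [lie_sum]
  refine Finset.sum_eq_zero fun e he => ?_
  exact t_four (ne hIJ ha hb) (ne hIK ha hc) (ne hIM ha he) (ne hJK hb hc) (ne hJM hb he)
    (ne hKM hc he)

variable (k) in
/-- `t_{ij} ↦ ∑_{α ∈ Iᵢ, β ∈ Iⱼ} t_{αβ}` on the free Lie algebra that covers `𝔱ₙ`. -/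
noncomputable def dFree {n m : ℕ} (I : Fin n → Finset (Fin m)) : FreeLieAlgebra k (Gen n) →ₗ⁅k⁆ T k m :=
  FreeLieAlgebra.lift k fun p => tSum k (I p.1.1) (I p.1.2)

theorem dFree_gen {n m : ℕ} (I : Fin n → Finset (Fin m)) {i j : Fin n} (h : i ≠ j) :
    dFree k I (gen k i j) = tSum k (I i) (I j) := by
  simp [dFree, gen, h]

theorem relIdeal_le_ker {n m : ℕ} (I : Fin n → Finset (Fin m))
    (hI : ∀ i j, i ≠ j → Disjoint (I i) (I j)) : relIdeal k n ≤ (dFree k I).ker := by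
  refine LieSubmodule.lieSpan_le.2 fun x hx => ?_
  refine (LieHom.mem_ker (f := dFree k I)).2 ?_
  induction hx with
  | symm i j hij =>
    rw [map_sub, dFree_gen I hij, dFree_gen I hij.symm, tSum_symm, sub_self]
  | three i j l hij hil hjl =>
    rw [LieHom.map_lie, map_add, dFree_gen I hij, dFree_gen I hil, dFree_gen I hjl]
    exact tSum_three (hI _ _ hij) (hI _ _ hil) (hI _ _ hjl)
  | four i j l p hij hil him hjl hjm hlm =>
    rw [LieHom.map_lie, dFree_gen I hij, dFree_gen I hlm]
    exact tSum_four (hI _ _ hij) (hI _ _ hil) (hI _ _ him) (hI _ _ hjl) (hI _ _ hjm)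
      (hI _ _ hlm)

variable (k) in
/-- For disjoint subsets `I₁, …, Iₙ` of the index set of `𝔱ₘ`, the Lie algebra morphism
`d^{I₁, …, Iₙ} : 𝔱ₙ → 𝔱ₘ`, `t_{ij} ↦ ∑_{α ∈ Iᵢ, β ∈ Iⱼ} t_{αβ}`. -/
noncomputable def d {n m : ℕ} (I : Fin n → Finset (Fin m)) (hI : ∀ i j, i ≠ j → Disjoint (I i) (I j)) :
    T k n →ₗ⁅k⁆ T k m where
  toLinearMap := (relIdeal k n).toSubmodule.liftQ
    (dFree k I : FreeLieAlgebra k (Gen n) →ₗ[k] T k m) fun x hx =>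
      LinearMap.mem_ker.2 ((LieHom.mem_ker (f := dFree k I)).1 (relIdeal_le_ker I hI hx))
  map_lie' := by
    intro x y
    obtain ⟨x, rfl⟩ := Submodule.Quotient.mk_surjective _ x
    obtain ⟨y, rfl⟩ := Submodule.Quotient.mk_surjective _ y
    exact LieHom.map_lie (dFree k I) x y

theorem d_t {n m : ℕ} (I : Fin n → Finset (Fin m)) (hI : ∀ i j, i ≠ j → Disjoint (I i) (I j))
    {i j : Fin n} (h : i ≠ j) : d k I hI (t k i j) = ∑ a ∈ I i, ∑ b ∈ I j, t k a b :=
  dFree_gen I h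

variable (k) in
/-- The identification of `𝔣₂(A, B)` with a Lie subalgebra of `𝔱₃`: `A = t₁₂`, `B = t₂₃`. -/
noncomputable def ofF2 : F2 k →ₗ⁅k⁆ T k 3 := F2.subst (t k 0 1) (t k 1 2)

end DK

/-! ## The relations that define `𝔤𝔯𝔱₁(k)` -/

namespace GRT

variable {k : Type*} [Field k]

/-- The duality relation `ψ(B, A) = -ψ(A, B)`. -/
def Duality (ψ : F2 k) : Prop := F2.subst (F2.B k) (F2.A k) ψ = -ψ

/-- The hexagon relation `ψ(A, B) + ψ(B, C) + ψ(C, A) = 0` with `C = -A - B`. -/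
def Hexagon (ψ : F2 k) : Prop :=
  ψ + F2.subst (F2.B k) (-F2.A k - F2.B k) ψ + F2.subst (-F2.A k - F2.B k) (F2.A k) ψ = 0

/-- The pentagon relation
`ψ^{12,3,4} - ψ^{1,23,4} + ψ^{1,2,34} = ψ^{2,3,4} + ψ^{1,2,3}` in `𝔱₄`. -/
def Pentagon (ψ : F2 k) : Prop :=
  DK.d k (m := 4) ![{0, 1}, {2}, {3}] (by decide) (DK.ofF2 k ψ)
    - DK.d k (m := 4) ![{0}, {1, 2}, {3}] (by decide) (DK.ofF2 k ψ)
    + DK.d k (m := 4) ![{0}, {1}, {2, 3}] (by decide) (DK.ofF2 k ψ)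
  = DK.d k (m := 4) ![{1}, {2}, {3}] (by decide) (DK.ofF2 k ψ)
    + DK.d k (m := 4) ![{0}, {1}, {2}] (by decide) (DK.ofF2 k ψ)

variable (k) in
/-- The underlying set of `𝔤𝔯𝔱₁(k)`: the solutions of the duality, hexagon and pentagon
relations. -/
def grt1 : Set (F2 k) := {ψ | Duality ψ ∧ Hexagon ψ ∧ Pentagon ψ}

end GRT

/-! ## The commutator subalgebra `𝔭`, its abelianization, and the isomorphism `i` -/

namespace F2

variable (k : Type*) [Field k]

/-- `𝔭 = [𝔣₂, 𝔣₂]`. -/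
noncomputable abbrev P : LieIdeal k (F2 k) := ⁅(⊤ : LieIdeal k (F2 k)), (⊤ : LieIdeal k (F2 k))⁆

/-- `[𝔭, 𝔭]`, as an ideal of the Lie algebra `𝔭`. -/
noncomputable abbrev PP : LieIdeal k (P k) := ⁅(⊤ : LieIdeal k (P k)), (⊤ : LieIdeal k (P k))⁆

/-- `𝔭 / [𝔭, 𝔭]`. -/
abbrev PAb : Type _ := P k ⧸ PP k

/-- The class in `𝔭 / [𝔭, 𝔭]` of an element of `𝔭`. -/
noncomputable def cls : P k →ₗ[k] PAb k := (PP k).toSubmodule.mkQ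

/-- `ad(A)^a ad(B)^b ([A, B])`, an element of `𝔭`. -/
noncomputable def bracketWord (a b : ℕ) : P k :=
  ⟨((LieAlgebra.ad k (F2 k) (A k)) ^ a * (LieAlgebra.ad k (F2 k) (B k)) ^ b) ⁅A k, B k⁆, by
    have h : ∀ (x : F2 k) (n : ℕ) (y : F2 k), y ∈ P k →
        ((LieAlgebra.ad k (F2 k) x) ^ n) y ∈ P k := by
      intro x n y hy
      induction n with
      | zero => simpa using hy
      | succ n ih => rw [pow_succ', Module.End.mul_apply]; exact (P k).lie_mem ih
    exact h _ _ _ (h _ _ _ (LieSubmodule.lie_mem_lie trivial trivial))⟩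

/-- `k[Ā, B̄]`, with `Ā = X 0` and `B̄ = X 1`. -/
abbrev Poly : Type _ := MvPolynomial (Fin 2) k

/-- The metabelian Lie algebra `k[Ā, B̄] ⊕ k[Ā, B̄]` with bracket
`[(u, v), (u', v')] = (0, u v' - u' v)`. -/
def Metab : Type _ := Poly k × Poly k

namespace Metab

noncomputable instance : AddCommGroup (Metab k) := inferInstanceAs (AddCommGroup (Poly k × Poly k))

noncomputable instance : Module k (Metab k) := inferInstanceAs (Module k (Poly k × Poly k))

/-- First component. -/
noncomputable def fst : Metab k →ₗ[k] Poly k := LinearMap.fst k (Poly k) (Poly k)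

/-- Second component. -/
noncomputable def snd : Metab k →ₗ[k] Poly k := LinearMap.snd k (Poly k) (Poly k)

variable {k} in
theorem ext' {x y : Metab k} (h1 : fst k x = fst k y) (h2 : snd k x = snd k y) : x = y :=
  Prod.ext h1 h2

noncomputable instance : Bracket (Metab k) (Metab k) :=
  ⟨fun x y => ((0, fst k x * snd k y - fst k y * snd k x) : Poly k × Poly k)⟩

@[simp] theorem fst_lie (x y : Metab k) : fst k ⁅x, y⁆ = 0 := rfl

@[simp] theorem snd_lie (x y : Metab k) :
    snd k ⁅x, y⁆ = fst k x * snd k y - fst k y * snd k x := rfl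

noncomputable instance : LieRing (Metab k) where
  add_lie x y z := ext' (by simp) (by simp; ring)
  lie_add x y z := ext' (by simp) (by simp; ring)
  lie_self x := ext' (by simp) (by simp)
  leibniz_lie x y z := ext' (by simp) (by simp; ring)

noncomputable instance : LieAlgebra k (Metab k) where
  lie_smul c x y := ext' (by simp) (by simp [smul_sub])

end Metab

/-- The morphism `𝔣₂ → Metab` with `A ↦ (Ā, 0)` and `B ↦ (B̄, B̄)`. -/
noncomputable def rho : F2 k →ₗ⁅k⁆ Metab k :=
  subst (L := Metab k) ((MvPolynomial.X 0, 0) : Poly k × Poly k)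
    ((MvPolynomial.X 1, MvPolynomial.X 1) : Poly k × Poly k)

theorem fst_rho_A : Metab.fst k (rho k (A k)) = MvPolynomial.X 0 := by
  simp only [rho, subst, A, FreeLieAlgebra.lift_of_apply]; rfl

theorem snd_rho_A : Metab.snd k (rho k (A k)) = 0 := by
  simp only [rho, subst, A, FreeLieAlgebra.lift_of_apply]; rfl

theorem fst_rho_B : Metab.fst k (rho k (B k)) = MvPolynomial.X 1 := by
  simp only [rho, subst, B, FreeLieAlgebra.lift_of_apply]; rfl

theorem snd_rho_B : Metab.snd k (rho k (B k)) = MvPolynomial.X 1 := by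
  simp only [rho, subst, B, FreeLieAlgebra.lift_of_apply]; rfl

variable {k}

theorem fst_rho_of_mem {x : F2 k} (hx : x ∈ P k) : Metab.fst k (rho k x) = 0 := by
  have : x ∈ (P k).toSubmodule := hx
  rw [LieSubmodule.lieIdeal_oper_eq_linear_span'] at this
  clear hx
  induction this using Submodule.span_induction with
  | mem x h => obtain ⟨u, -, v, -, rfl⟩ := h; simp
  | zero => simp
  | add x y _ _ hx hy => simp_all
  | smul a x _ hx => simp_all

variable (k) in
/-- The linear map `𝔭 → k[Ā, B̄]` that induces `i`. -/
noncomputable def iP : P k →ₗ[k] Poly k :=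
  Metab.snd k ∘ₗ (rho k : F2 k →ₗ[k] Metab k) ∘ₗ (P k).toSubmodule.subtype

theorem iP_apply (x : P k) : iP k x = Metab.snd k (rho k (x : F2 k)) := rfl

theorem iP_of_mem {x : P k} (hx : x ∈ PP k) : iP k x = 0 := by
  have : x ∈ (PP k).toSubmodule := hx
  rw [LieSubmodule.lieIdeal_oper_eq_linear_span'] at this
  clear hx
  induction this using Submodule.span_induction with
  | mem x h =>
    obtain ⟨u, -, v, -, rfl⟩ := h
    simp [iP_apply, fst_rho_of_mem u.2, fst_rho_of_mem v.2]
  | zero => simp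
  | add x y _ _ hx hy => simp_all
  | smul a x _ hx => simp_all

variable (k) in
/-- `i` as a linear map to `k[Ā, B̄]`. -/
noncomputable def iLin : PAb k →ₗ[k] Poly k :=
  (PP k).toSubmodule.liftQ (iP k) fun _ hx => iP_of_mem hx

@[simp] theorem iLin_cls (x : P k) : iLin k (cls k x) = iP k x := rfl

theorem iP_bracketWord (a b : ℕ) :
    iP k (bracketWord k a b) = MvPolynomial.X 0 ^ (a + 1) * MvPolynomial.X 1 ^ (b + 1) := by
  have hB : ∀ b : ℕ, Metab.snd k (rho k (bracketWord k 0 b : F2 k))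
      = MvPolynomial.X 0 * MvPolynomial.X 1 ^ (b + 1) := by
    intro b
    induction b with
    | zero => simp [bracketWord, fst_rho_A, fst_rho_B, snd_rho_A, snd_rho_B]
    | succ b ih =>
      have : (bracketWord k 0 (b + 1) : F2 k) = ⁅B k, (bracketWord k 0 b : F2 k)⁆ := by
        simp [bracketWord, pow_succ']
      rw [this, LieHom.map_lie, Metab.snd_lie, ih, fst_rho_of_mem (bracketWord k 0 b).2,
        fst_rho_B]
      ring
  rw [iP_apply]
  induction a with
  | zero => rw [hB]; ring
  | succ a ih =>
    have : (bracketWord k (a + 1) b : F2 k) = ⁅A k, (bracketWord k a b : F2 k)⁆ := by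
      simp [bracketWord, pow_succ']
    rw [this, LieHom.map_lie, Metab.snd_lie, ih, fst_rho_of_mem (bracketWord k a b).2, fst_rho_A]
    ring

/-- A subspace stable under `ad A` and `ad B` is an ideal. -/
theorem lie_mem_of_generators (W : Submodule k (F2 k)) (hA : ∀ w ∈ W, ⁅A k, w⁆ ∈ W)
    (hB : ∀ w ∈ W, ⁅B k, w⁆ ∈ W) (x : F2 k) : ∀ w ∈ W, ⁅x, w⁆ ∈ W := by
  let S : LieSubalgebra k (F2 k) :=
    { carrier := {x | ∀ w ∈ W, ⁅x, w⁆ ∈ W}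
      add_mem' := fun {a b} ha hb w hw => by rw [add_lie]; exact W.add_mem (ha w hw) (hb w hw)
      zero_mem' := fun w _ => by simp
      smul_mem' := fun c x hx w hw => by rw [smul_lie]; exact W.smul_mem c (hx w hw)
      lie_mem' := fun {a b} ha hb w hw => by
        rw [lie_lie]; exact W.sub_mem (ha _ (hb w hw)) (hb _ (ha w hw)) }
  have hgen : ∀ j : Fin 2, FreeLieAlgebra.of k j ∈ S := by
    intro j
    fin_cases j
    · exact hA
    · exact hB
  let g : F2 k →ₗ⁅k⁆ S := FreeLieAlgebra.lift k fun j => ⟨FreeLieAlgebra.of k j, hgen j⟩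
  have hg : S.incl.comp g = LieHom.id := FreeLieAlgebra.hom_ext (by intro j; simp [g])
  have : x = (g x : F2 k) := (LieHom.congr_fun hg x).symm
  rw [this]
  exact (g x).2

variable (k) in
/-- The classes `p_{a+1,b+1}` span `𝔭 / [𝔭, 𝔭]`. -/
theorem span_cls_bracketWord :
    Submodule.span k (Set.range fun q : ℕ × ℕ => cls k (bracketWord k q.1 q.2)) = ⊤ := by
  set V := Submodule.span k (Set.range fun q : ℕ × ℕ => cls k (bracketWord k q.1 q.2)) with hV
  -- W is the preimage of `V` in `𝔭`
  let W : Submodule k (F2 k) := (V.comap (cls k)).map (P k).toSubmodule.subtype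
  have mW : ∀ x : P k, (x : F2 k) ∈ W ↔ cls k x ∈ V := by
    intro x
    constructor
    · rintro ⟨y, hy, hyx⟩
      have : y = x := Subtype.ext hyx
      exact this ▸ hy
    · exact fun h => ⟨x, h, rfl⟩
  have WP : ∀ w ∈ W, w ∈ P k := by rintro _ ⟨y, -, rfl⟩; exact y.2
  let adP : F2 k → P k →ₗ[k] P k := fun z => LieModule.toEnd k (F2 k) (P k) z
  have adP_coe : ∀ z (x : P k), ((adP z x : P k) : F2 k) = ⁅z, (x : F2 k)⁆ := fun _ _ => rfl
  have hPP : ∀ x y : P k, cls k ⁅x, y⁆ = 0 := fun x y =>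
    (Submodule.Quotient.mk_eq_zero _).2
      (LieSubmodule.lie_mem_lie (LieSubmodule.mem_top x) (LieSubmodule.mem_top y))
  have stabPP : ∀ z (x : P k), cls k x = 0 → cls k (adP z x) = 0 := by
    intro z x hx
    have hx' : x ∈ (PP k).toSubmodule := (Submodule.Quotient.mk_eq_zero _).1 hx
    rw [LieSubmodule.lieIdeal_oper_eq_linear_span'] at hx'
    clear hx
    induction hx' using Submodule.span_induction with
    | mem x h =>
      obtain ⟨u, -, v, -, rfl⟩ := h
      have : adP z ⁅u, v⁆ = ⁅adP z u, v⁆ + ⁅u, adP z v⁆ :=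
        Subtype.ext (leibniz_lie z (u : F2 k) (v : F2 k))
      rw [this, map_add, hPP, hPP, add_zero]
    | zero => simp
    | add x y _ _ hx hy => rw [map_add, map_add, hx, hy, add_zero]
    | smul a x _ hx => rw [map_smul, map_smul, hx, smul_zero]
  have stab : ∀ z, (∀ q : ℕ × ℕ, cls k (adP z (bracketWord k q.1 q.2)) ∈ V) →
      ∀ w ∈ W, ⁅z, w⁆ ∈ W := by
    rintro z hz _ ⟨y, hy, rfl⟩
    change ((adP z y : P k) : F2 k) ∈ W
    rw [mW]
    have hle : V ≤ Submodule.map (cls k) ((V.comap (cls k ∘ₗ adP z))) := by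
      refine Submodule.span_le.2 ?_
      rintro _ ⟨q, rfl⟩
      exact ⟨_, hz q, rfl⟩
    obtain ⟨y', hy', e⟩ := hle hy
    have h0 : cls k (y - y') = 0 := by rw [map_sub, e, sub_self]
    have h1 := stabPP z _ h0
    rw [map_sub, map_sub, sub_eq_zero] at h1
    rw [h1]
    exact hy'
  have wordA : ∀ a b, adP (A k) (bracketWord k a b) = bracketWord k (a + 1) b := by
    intro a b
    apply Subtype.ext
    rw [adP_coe]
    simp [bracketWord, pow_succ']
  have wordB : ∀ a b, cls k (adP (B k) (bracketWord k a b)) = cls k (bracketWord k a (b + 1)) := by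
    intro a b
    induction a with
    | zero =>
      congr 1
      apply Subtype.ext
      rw [adP_coe]
      simp [bracketWord, pow_succ']
    | succ a ih =>
      let c : P k := ⟨⁅B k, A k⁆, LieSubmodule.lie_mem_lie trivial trivial⟩
      have e1 : adP (B k) (bracketWord k (a + 1) b)
          = ⁅c, bracketWord k a b⁆ + adP (A k) (adP (B k) (bracketWord k a b)) := by
        rw [← wordA]
        exact Subtype.ext (leibniz_lie (B k) (A k) (bracketWord k a b : F2 k))
      rw [e1, map_add, hPP, zero_add, ← wordA]
      have h0 : cls k (adP (B k) (bracketWord k a b) - bracketWord k a (b + 1)) = 0 := by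
        rw [map_sub, ih, sub_self]
      have h1 := stabPP (A k) _ h0
      rwa [map_sub, map_sub, sub_eq_zero] at h1
  have hWA := stab (A k) fun q => by
    rw [wordA]; exact Submodule.subset_span ⟨(q.1 + 1, q.2), rfl⟩
  have hWB := stab (B k) fun q => by
    rw [wordB]; exact Submodule.subset_span ⟨(q.1, q.2 + 1), rfl⟩
  have hW := lie_mem_of_generators W hWA hWB
  have hAB : ⁅A k, B k⁆ ∈ W := by
    have : ((bracketWord k 0 0 : P k) : F2 k) ∈ W :=
      (mW _).2 (Submodule.subset_span ⟨(0, 0), rfl⟩)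
    simpa [bracketWord] using this
  -- `W + kA + kB` is everything, and `W` contains all brackets
  let U : Submodule k (F2 k) := W ⊔ Submodule.span k {A k, B k}
  have hgenU : ∀ z, (z = A k ∨ z = B k) → ∀ u ∈ U, ⁅z, u⁆ ∈ W := by
    intro z hz u hu
    obtain ⟨w, hw, s, hs, rfl⟩ := Submodule.mem_sup.1 hu
    rw [lie_add]
    refine W.add_mem (hW z w hw) ?_
    obtain ⟨α, β, rfl⟩ := Submodule.mem_span_pair.1 hs
    rw [lie_add, lie_smul, lie_smul]
    rcases hz with rfl | rfl
    · rw [lie_self, smul_zero, zero_add]; exact W.smul_mem _ hAB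
    · rw [lie_self, smul_zero, add_zero, ← lie_skew]
      exact W.smul_mem _ (W.neg_mem hAB)
  have hU : ∀ x, ∀ u ∈ U, ⁅x, u⁆ ∈ U := lie_mem_of_generators U
    (fun u hu => (le_sup_left : W ≤ U) (hgenU _ (Or.inl rfl) u hu))
    (fun u hu => (le_sup_left : W ≤ U) (hgenU _ (Or.inr rfl) u hu))
  have brU : ∀ u ∈ U, ∀ v ∈ U, ⁅u, v⁆ ∈ W := by
    intro u hu v hv
    obtain ⟨w, hw, s, hs, rfl⟩ := Submodule.mem_sup.1 hu
    rw [add_lie]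
    refine W.add_mem ?_ ?_
    · rw [← lie_skew]; exact W.neg_mem (hW v w hw)
    · obtain ⟨α, β, rfl⟩ := Submodule.mem_span_pair.1 hs
      rw [add_lie, smul_lie, smul_lie]
      exact W.add_mem (W.smul_mem _ (hgenU _ (Or.inl rfl) v hv))
        (W.smul_mem _ (hgenU _ (Or.inr rfl) v hv))
  let S : LieSubalgebra k (F2 k) := { U with lie_mem' := fun {a b} _ hb => hU a b hb }
  have hgenS : ∀ j : Fin 2, FreeLieAlgebra.of k j ∈ S := by
    intro j
    refine (le_sup_right : Submodule.span k {A k, B k} ≤ U) (Submodule.subset_span ?_)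
    fin_cases j
    · exact Or.inl rfl
    · exact Or.inr rfl
  let g : F2 k →ₗ⁅k⁆ S := FreeLieAlgebra.lift k fun j => ⟨FreeLieAlgebra.of k j, hgenS j⟩
  have hg : S.incl.comp g = LieHom.id := FreeLieAlgebra.hom_ext (by intro j; simp [g])
  have hall : ∀ x : F2 k, x ∈ U := fun x => by
    have : x = (g x : F2 k) := (LieHom.congr_fun hg x).symm
    rw [this]; exact (g x).2
  have hPW : (P k).toSubmodule ≤ W := by
    rw [LieSubmodule.lieIdeal_oper_eq_linear_span', Submodule.span_le]
    rintro _ ⟨u, -, v, -, rfl⟩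
    exact brU u (hall u) v (hall v)
  refine eq_top_iff.2 fun y _ => ?_
  obtain ⟨x, rfl⟩ := Submodule.Quotient.mk_surjective _ y
  exact (mW x).1 (hPW x.2)

variable (k) in
/-- The ideal `(Ā B̄)` of `k[Ā, B̄]`. -/
noncomputable abbrev idealAB : Ideal (Poly k) := Ideal.span {MvPolynomial.X 0 * MvPolynomial.X 1}

theorem iLin_injective : Function.Injective (iLin k) := by
  let v : ℕ × ℕ → PAb k := fun q => cls k (bracketWord k q.1 q.2)
  have hli : LinearIndependent k (iLin k ∘ v) := by
    let e : ℕ × ℕ → (Fin 2 →₀ ℕ) := fun q =>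
      Finsupp.single 0 (q.1 + 1) + Finsupp.single 1 (q.2 + 1)
    have he : Function.Injective e := by
      intro q q' h
      have h0 := DFunLike.congr_fun h 0
      have h1 := DFunLike.congr_fun h 1
      simp [e] at h0 h1
      exact Prod.ext h0 h1
    have h := (MvPolynomial.basisMonomials (Fin 2) k).linearIndependent.comp e he
    have heq : iLin k ∘ v = MvPolynomial.basisMonomials (Fin 2) k ∘ e := by
      funext q
      simp [v, e, iP_bracketWord, MvPolynomial.X_pow_eq_monomial, MvPolynomial.monomial_mul]
    rw [heq]
    exact h
  refine (injective_iff_map_eq_zero (iLin k)).2 fun x hx => ?_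
  have hxs : x ∈ Submodule.span k (Set.range v) := by
    rw [show Submodule.span k (Set.range v) = ⊤ from span_cls_bracketWord k]; trivial
  obtain ⟨c, rfl⟩ := (Finsupp.mem_span_range_iff_exists_finsupp).1 hxs
  have hc : c = 0 := by
    refine (linearIndependent_iff.1 hli) c ?_
    rw [Finsupp.linearCombination_apply]
    simpa [Finsupp.sum, map_sum] using hx
  simp [hc]

theorem range_iLin : LinearMap.range (iLin k) = (idealAB k).restrictScalars k := by
  apply le_antisymm
  · rw [LinearMap.range_eq_map, ← span_cls_bracketWord k, Submodule.map_span_le]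
    rintro _ ⟨q, rfl⟩
    rw [iLin_cls, iP_bracketWord]
    refine Ideal.mem_span_singleton.2
      ⟨MvPolynomial.X 0 ^ q.1 * MvPolynomial.X 1 ^ q.2, by ring⟩
  · intro f hf
    obtain ⟨r, rfl⟩ := Ideal.mem_span_singleton.1 hf
    clear hf
    induction r using MvPolynomial.induction_on' with
    | monomial u a =>
      refine ⟨a • cls k (bracketWord k (u 0) (u 1)), ?_⟩
      rw [map_smul, iLin_cls, iP_bracketWord, MvPolynomial.monomial_eq, MvPolynomial.smul_eq_C_mul,
        Finsupp.prod_fintype _ _ (by simp), Fin.prod_univ_two]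
      ring
    | add p q hp hq => rw [mul_add]; exact Submodule.add_mem _ hp hq

variable (k) in
/-- The isomorphism `i : 𝔭 / [𝔭, 𝔭] ≃ (Ā B̄)`. It is determined by `i_bracketWord`. -/
noncomputable def i : PAb k ≃ₗ[k] idealAB k :=
  LinearEquiv.ofBijective
    ((iLin k).codRestrict ((idealAB k).restrictScalars k) fun x =>
      range_iLin (k := k) ▸ LinearMap.mem_range_self (iLin k) x)
    ⟨fun _ _ h => iLin_injective (congrArg Subtype.val h), fun y => by
      have hy : (y : Poly k) ∈ LinearMap.range (iLin k) := by rw [range_iLin]; exact y.2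
      obtain ⟨x, hx⟩ := hy
      exact ⟨x, Subtype.ext hx⟩⟩

/-- `i` sends the class of `ad(A)^{a} ad(B)^{b} ([A, B])` to `Ā^{a+1} B̄^{b+1}`. -/
theorem i_bracketWord (a b : ℕ) :
    ((i k (cls k (bracketWord k a b)) : idealAB k) : Poly k)
      = MvPolynomial.X 0 ^ (a + 1) * MvPolynomial.X 1 ^ (b + 1) :=
  iP_bracketWord a b

variable (k) in
/-- `(Ā + B̄)ⁿ - Āⁿ - B̄ⁿ`. -/
noncomputable def drinfeldPoly (n : ℕ) : Poly k :=
  (MvPolynomial.X 0 + MvPolynomial.X 1) ^ n - MvPolynomial.X 0 ^ n - MvPolynomial.X 1 ^ n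

end F2

/-!
The proof computes the trace of `ψ(t₁₂, t₂₃)` in a representation of `𝔱₄` in two ways.

Strands are numbered `0, 1, 2, 3`. The elements `t₀₁, t₀₂, t₀₃` generate a free ideal of `𝔱₄`, on
which `t₁₂, t₁₃, t₂₃` act by derivations. Passing to the metabelian quotient of this ideal and
using Magnus coordinates gives the infinitesimal Gassner representation `DK.gassner`: with
`xᵢ` the image of `t₀ᵢ` in a commutative ring `S`, the element `t₀ᵢ` becomes the affine map
`v ↦ xᵢ v + eᵢ` of `S³`, and `tᵢⱼ` becomes a linear map of `S³`. As `ψ` is a sum of brackets, the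
matrix of `ψ(t₁₂, t₂₃)` has trace `0`. On the other hand, its diagonal entries can be read off from
`[ψ(t₁₂, t₂₃), t₀ᵢ]`. The pentagon relation, applied to three orderings of the strands, writes
`ψ(t₁₂, t₂₃)` as a term commuting with `t₀ᵢ` plus terms that lie in the free ideal
(`GRT.Pentagon.lie_subst_left`, `GRT.Pentagon.lie_subst_middle`, `GRT.Pentagon.lie_subst_right`).
On such terms only the class of `ψ` in `𝔭 / [𝔭, 𝔭]` matters: if `i([ψ]) = Ā B̄ q`, the value of `ψ`
at a pair `(y, z)` generating a suitable metabelian Lie algebra is `q(ad y, ad z) [y, z]`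
(`F2.IsMetabValue`). The result is a linear relation between values of `q`
(`GRT.Pentagon.trace_eq_zero`).

The pentagon relation also implies duality, by the morphism `𝔱₄ → 𝔣₂` that identifies complementary
pairs of strands (`GRT.Pentagon.duality`). Duality makes `q` symmetric, and the hexagon relation
gives `q(a, b) + q(b, c) + q(c, a) = 0` for `a + b + c = 0`. These turn the trace relation into the
statement that `f = Ā B̄ q` is a 2-cocycle, `f(x, y) + f(x + y, z) = f(y, z) + f(x, y + z)`
(`GRT.Pentagon.cocycle`). Differentiating in `z` at `z = 0` and using Euler's identity shows that a
symmetric homogeneous cocycle of degree `n` is a multiple of `(Ā + B̄)ⁿ - Āⁿ - B̄ⁿ`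
(`F2.exists_smul_eq_of_cocycle`). For even `n` the hexagon relation makes the multiple zero. In
degree `1` the pentagon relation, evaluated in an abelian Lie algebra, already gives `ψ = 0`.
-/

universe u

/-! ### Substitution and induction in the free Lie algebra -/

namespace F2

variable {k : Type*} [Field k]

section Subst

variable {L : Type*} [LieRing L] [LieAlgebra k L]

@[simp] theorem subst_A (x y : L) : subst x y (A k) = x := by
  simp [subst, A]

@[simp] theorem subst_B (x y : L) : subst x y (B k) = y := by
  simp [subst, B]

/-- Induction over the Lie algebra operations, starting from the free generators. -/
theorem induction_on {p : F2 k → Prop} (ψ : F2 k) (hA : p (A k)) (hB : p (B k))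
    (hadd : ∀ x y, p x → p y → p (x + y)) (hsmul : ∀ (c : k) x, p x → p (c • x))
    (hlie : ∀ x y, p x → p y → p ⁅x, y⁆) : p ψ := by
  let S : LieSubalgebra k (F2 k) :=
    { carrier := {x | p x}
      add_mem' := fun {a b} ha hb => hadd a b ha hb
      zero_mem' := by simpa using hsmul 0 _ hA
      smul_mem' := fun c x hx => hsmul c x hx
      lie_mem' := fun {a b} ha hb => hlie a b ha hb }
  let g : F2 k →ₗ⁅k⁆ S := subst ⟨A k, hA⟩ ⟨B k, hB⟩
  have hg : S.incl.comp g = LieHom.id :=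
    FreeLieAlgebra.hom_ext (by intro j; fin_cases j <;> simp [g, subst] <;> rfl)
  have : ψ = (g ψ : F2 k) := (LieHom.congr_fun hg ψ).symm
  rw [this]
  exact (g ψ).2

/-- Induction over the commutator ideal `𝔭`, starting from brackets. -/
@[elab_as_elim]
theorem P_induction_on {p : F2 k → Prop} {ψ : F2 k} (hψ : ψ ∈ P k)
    (hlie : ∀ x y : F2 k, p ⁅x, y⁆) (hadd : ∀ x y, p x → p y → p (x + y))
    (hsmul : ∀ (c : k) x, p x → p (c • x)) : p ψ := by
  have h : ψ ∈ (P k).toSubmodule := hψ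
  rw [LieSubmodule.lieIdeal_oper_eq_linear_span'] at h
  clear hψ
  induction h using Submodule.span_induction with
  | mem x h => obtain ⟨u, -, v, -, rfl⟩ := h; exact hlie u v
  | zero => simpa using hsmul 0 _ (hlie 0 0)
  | add x y _ _ hx hy => exact hadd x y hx hy
  | smul a x _ hx => exact hsmul a x hx

theorem map_subst {L' : Type*} [LieRing L'] [LieAlgebra k L'] (φ : L →ₗ⁅k⁆ L') (x y : L)
    (ψ : F2 k) : φ (subst x y ψ) = subst (φ x) (φ y) ψ := by
  have : φ.comp (subst x y) = subst (φ x) (φ y) :=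
    FreeLieAlgebra.hom_ext (by intro j; fin_cases j <;> simp [subst])
  exact LieHom.congr_fun this ψ

theorem subst_A_B (ψ : F2 k) : subst (A k) (B k) ψ = ψ := by
  have : subst (A k) (B k) = LieHom.id :=
    FreeLieAlgebra.hom_ext (by intro j; fin_cases j <;> simp [subst] <;> rfl)
  rw [this]; rfl

theorem lie_subst_eq_zero {x y c : L} (hx : ⁅x, c⁆ = 0) (hy : ⁅y, c⁆ = 0) (ψ : F2 k) :
    ⁅subst x y ψ, c⁆ = 0 := by
  induction ψ using induction_on with
  | hA => simpa using hx
  | hB => simpa using hy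
  | hadd u v hu hv => rw [map_add, add_lie, hu, hv, add_zero]
  | hsmul a u hu => rw [map_smul, smul_lie, hu, smul_zero]
  | hlie u v hu hv => rw [LieHom.map_lie, lie_lie, hu, hv, lie_zero, lie_zero, sub_zero]

theorem exists_subst_eq_of_lie_eq_zero {x y : L} (h : ⁅x, y⁆ = 0) (ψ : F2 k) :
    ∃ α β : k, subst x y ψ = α • x + β • y := by
  have h' : ⁅y, x⁆ = 0 := by rw [← lie_skew, h, neg_zero]
  induction ψ using induction_on with
  | hA => exact ⟨1, 0, by simp⟩
  | hB => exact ⟨0, 1, by simp⟩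
  | hadd u v hu hv =>
    obtain ⟨a, b, hu⟩ := hu
    obtain ⟨a', b', hv⟩ := hv
    exact ⟨a + a', b + b', by rw [map_add, hu, hv]; module⟩
  | hsmul c u hu =>
    obtain ⟨a, b, hu⟩ := hu
    exact ⟨c * a, c * b, by rw [map_smul, hu]; module⟩
  | hlie u v hu hv =>
    obtain ⟨a, b, hu⟩ := hu
    obtain ⟨a', b', hv⟩ := hv
    exact ⟨0, 0, by simp [LieHom.map_lie, hu, hv, h, h']⟩

theorem subst_eq_zero_of_lie_eq_zero {x y : L} (h : ⁅x, y⁆ = 0) {ψ : F2 k} (hψ : ψ ∈ P k) :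
    subst x y ψ = 0 := by
  refine P_induction_on hψ (fun u v => ?_) (fun u v hu hv => ?_) (fun a u hu => ?_)
  · obtain ⟨a, b, hu⟩ := exists_subst_eq_of_lie_eq_zero h u
    obtain ⟨a', b', hv⟩ := exists_subst_eq_of_lie_eq_zero h v
    have h' : ⁅y, x⁆ = 0 := by rw [← lie_skew, h, neg_zero]
    simp [LieHom.map_lie, hu, hv, h, h']
  · rw [map_add, hu, hv, add_zero]
  · rw [map_smul, hu, smul_zero]

end Subst

/-! ### Homogeneous elements -/

theorem IsLieWord.pos {n : ℕ} {w : F2 k} (h : IsLieWord n w) : 0 < n := by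
  induction h with
  | of x => exact one_pos
  | lie _ _ h _ => omega

theorem eq_zero_of_mem_homogeneous_zero {ψ : F2 k} (h : ψ ∈ homogeneous k 0) : ψ = 0 := by
  have : {w : F2 k | IsLieWord 0 w} = ∅ :=
    Set.eq_empty_of_forall_notMem fun w hw => hw.pos.ne rfl
  rwa [homogeneous, this, Submodule.span_empty, Submodule.mem_bot] at h

theorem exists_eq_of_mem_homogeneous_one {ψ : F2 k} (h : ψ ∈ homogeneous k 1) :
    ∃ α β : k, ψ = α • A k + β • B k := by
  have hw : ∀ n (w : F2 k), IsLieWord n w → n = 1 → w ∈ Submodule.span k {A k, B k} := by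
    intro n w hw hn
    cases hw with
    | of x => fin_cases x <;> exact Submodule.subset_span (by simp [A, B])
    | lie hu hv =>
      have := hu.pos
      have := hv.pos
      omega
  have : ψ ∈ Submodule.span k {A k, B k} := Submodule.span_le.2 (fun w h => hw 1 w h rfl) h
  obtain ⟨a, b, h⟩ := Submodule.mem_span_pair.1 this
  exact ⟨a, b, h.symm⟩

theorem mem_P_of_mem_homogeneous {n : ℕ} (hn : 2 ≤ n) {ψ : F2 k} (h : ψ ∈ homogeneous k n) :
    ψ ∈ P k := by
  have hle : homogeneous k n ≤ (P k).toSubmodule := by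
    refine Submodule.span_le.2 ?_
    intro w hw
    change IsLieWord n w at hw
    cases hw with
    | of x => omega
    | lie hu hv => exact LieSubmodule.lie_mem_lie trivial trivial
  exact hle h

theorem isHomogeneous_snd_rho {n : ℕ} {ψ : F2 k} (h : ψ ∈ homogeneous k n) :
    (Metab.snd k (rho k ψ)).IsHomogeneous n := by
  have hw : ∀ n (w : F2 k), IsLieWord n w → (Metab.fst k (rho k w)).IsHomogeneous n ∧
      (Metab.snd k (rho k w)).IsHomogeneous n := by
    intro n w hw
    induction hw with
    | of x =>
      fin_cases x
      · exact ⟨fst_rho_A k ▸ MvPolynomial.isHomogeneous_X k 0,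
          snd_rho_A k ▸ MvPolynomial.isHomogeneous_zero _ _ _⟩
      · exact ⟨fst_rho_B k ▸ MvPolynomial.isHomogeneous_X k 1,
          snd_rho_B k ▸ MvPolynomial.isHomogeneous_X k 1⟩
    | @lie m n u v _ _ hu hv =>
      rw [LieHom.map_lie, Metab.fst_lie, Metab.snd_lie]
      exact ⟨MvPolynomial.isHomogeneous_zero _ _ _,
        (hu.1.mul hv.2).sub (add_comm n m ▸ hv.1.mul hu.2)⟩
  induction h using Submodule.span_induction with
  | mem x h => exact (hw n x h).2
  | zero => simpa using MvPolynomial.isHomogeneous_zero _ _ _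
  | add x y _ _ hx hy => rw [map_add, map_add]; exact hx.add hy
  | smul a x _ hx =>
    rw [map_smul, map_smul, MvPolynomial.smul_eq_C_mul]
    simpa using (MvPolynomial.isHomogeneous_C _ a).mul hx

/-! ### Evaluation in metabelian Lie algebras -/

/-- The pair `(y, z)` generates a metabelian Lie algebra of rank one: the ideal generated by
`[y, z]` is contained in the abelian subspace `ι S`, where `ι 1 = [y, z]`, and `y` and `z` act on
`ι S` through multiplication by `u` and `v`. -/
structure IsMetabPair {S L : Type*} [CommRing S] [Algebra k S] [LieRing L] [LieAlgebra k L]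
    (ι : S →ₗ[k] L) (u v : S) (y z : L) : Prop where
  lie_eq : ⁅y, z⁆ = ι 1
  lie_left (s : S) : ⁅y, ι s⁆ = ι (u * s)
  lie_right (s : S) : ⁅z, ι s⁆ = ι (v * s)
  lie_lie (s t : S) : ⁅ι s, ι t⁆ = 0

/-- The span of `y`, `z` and `ι S` is closed under the bracket. -/
theorem IsMetabPair.lie_combination {S L : Type*} [CommRing S] [Algebra k S] [LieRing L]
    [LieAlgebra k L] {ι : S →ₗ[k] L} {u v : S} {y z : L} (h : IsMetabPair ι u v y z)
    (a b a' b' : k) (s s' : S) :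
    ⁅a • y + b • z + ι s, a' • y + b' • z + ι s'⁆ =
      ι ((a * b' - a' * b) • 1 + (a • u + b • v) * s' - (a' • u + b' • v) * s) := by
  have hzy : ⁅z, y⁆ = -ι 1 := by rw [← lie_skew, h.lie_eq]
  have hl (s) : ⁅ι s, y⁆ = -ι (u * s) := by rw [← lie_skew, h.lie_left]
  have hr (s) : ⁅ι s, z⁆ = -ι (v * s) := by rw [← lie_skew, h.lie_right]
  simp only [lie_add, add_lie, lie_smul, smul_lie, lie_self, h.lie_eq, hzy, hl, hr, h.lie_left,
    h.lie_right, h.lie_lie, map_add, map_sub, map_smul, add_mul, smul_mul_assoc]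
  module

end F2

namespace F2

-- The polynomial `q` below is chosen before the Lie algebra in which `ψ` is evaluated, so the
-- universe of the latter has to be fixed; that of `k` contains all the examples that occur.
variable {k : Type u} [Field k]

/-- Modulo `[𝔭, 𝔭]`, every element of `𝔣₂` is `α A + β B + q(ad A, ad B) [A, B]` for a
polynomial `q`. -/
theorem exists_subst_eq (ψ : F2 k) : ∃ (α β : k) (q : Poly k),
    ∀ {S L : Type u} [CommRing S] [Algebra k S] [LieRing L] [LieAlgebra k L]
      {ι : S →ₗ[k] L} {u v : S} {y z : L}, IsMetabPair ι u v y z →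
      subst y z ψ = α • y + β • z + ι (MvPolynomial.aeval ![u, v] q) := by
  induction ψ using induction_on with
  | hA => exact ⟨1, 0, 0, by simp⟩
  | hB => exact ⟨0, 1, 0, by simp⟩
  | hadd x y hx hy =>
    obtain ⟨a, b, q, hx⟩ := hx
    obtain ⟨a', b', q', hy⟩ := hy
    refine ⟨a + a', b + b', q + q', fun h => ?_⟩
    rw [map_add, hx h, hy h, map_add, map_add]
    module
  | hsmul c x hx =>
    obtain ⟨a, b, q, hx⟩ := hx
    refine ⟨c * a, c * b, c • q, fun h => ?_⟩
    rw [map_smul, hx h, map_smul, map_smul]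
    module
  | hlie x y hx hy =>
    obtain ⟨a, b, q, hx⟩ := hx
    obtain ⟨a', b', q', hy⟩ := hy
    refine ⟨0, 0, (a * b' - a' * b) • 1 + (a • MvPolynomial.X 0 + b • MvPolynomial.X 1) * q'
      - (a' • MvPolynomial.X 0 + b' • MvPolynomial.X 1) * q, fun h => ?_⟩
    rw [LieHom.map_lie, hx h, hy h, h.lie_combination]
    simp

/-- `q` describes `ψ` modulo `[𝔭, 𝔭]`: the value of `ψ` at a pair that generates a metabelian Lie
algebra of rank one is `q(u, v) [y, z]`. -/
def IsMetabValue (ψ : F2 k) (q : Poly k) : Prop :=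
  ∀ {S L : Type u} [CommRing S] [Algebra k S] [LieRing L] [LieAlgebra k L]
    {ι : S →ₗ[k] L} {u v : S} {y z : L}, IsMetabPair ι u v y z →
    subst y z ψ = ι (MvPolynomial.aeval ![u, v] q)

theorem exists_isMetabValue {ψ : F2 k} (hψ : ψ ∈ P k) : ∃ q : Poly k, IsMetabValue ψ q := by
  refine P_induction_on hψ (fun x y => ?_) ?_ ?_
  · obtain ⟨a, b, q, hx⟩ := exists_subst_eq x
    obtain ⟨a', b', q', hy⟩ := exists_subst_eq y
    refine ⟨(a * b' - a' * b) • 1 + (a • MvPolynomial.X 0 + b • MvPolynomial.X 1) * q'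
      - (a' • MvPolynomial.X 0 + b' • MvPolynomial.X 1) * q, fun h => ?_⟩
    rw [LieHom.map_lie, hx h, hy h, h.lie_combination]
    simp
  · rintro x y ⟨q, hx⟩ ⟨q', hy⟩
    exact ⟨q + q', fun h => by rw [map_add, hx h, hy h, map_add, map_add]⟩
  · rintro c x ⟨q, hx⟩
    exact ⟨c • q, fun h => by rw [map_smul, hx h, map_smul, map_smul]⟩

/-- The case `ι s = s • [y, z]`, for Lie algebras over `S`. -/
theorem IsMetabValue.subst_eq_smul {ψ : F2 k} {q : Poly k} (hq : IsMetabValue ψ q) {S L : Type u}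
    [CommRing S] [Algebra k S] [LieRing L] [LieAlgebra k L] [LieAlgebra S L] [IsScalarTower k S L]
    {u v : S} {y z w : L} (hw : ⁅y, z⁆ = w) (hu : ⁅y, w⁆ = u • w) (hv : ⁅z, w⁆ = v • w) :
    subst y z ψ = MvPolynomial.aeval ![u, v] q • w :=
  hq (ι := (LinearMap.toSpanSingleton S L w).restrictScalars k)
    { lie_eq := by simp [hw]
      lie_left := fun s => by simp [hu, smul_smul, mul_comm]
      lie_right := fun s => by simp [hv, smul_smul, mul_comm]
      lie_lie := fun s t => by simp }

end F2

/-! ### Families satisfying the relations of `𝔱₄` -/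

namespace DK

variable {k : Type*} [Field k] {L : Type*} [LieRing L] [LieAlgebra k L]

/-- The defining relations of `𝔱₄`, for a symmetric family of elements of a Lie algebra. -/
structure IsFamily (s : Fin 4 → Fin 4 → L) : Prop where
  symm (i j : Fin 4) : s i j = s j i
  three (i j l : Fin 4) : i ≠ j → i ≠ l → j ≠ l → ⁅s i j + s i l, s j l⁆ = 0
  four (i j l m : Fin 4) : i ≠ j → i ≠ l → i ≠ m → j ≠ l → j ≠ m → l ≠ m → ⁅s i j, s l m⁆ = 0

theorem IsFamily.comp {s : Fin 4 → Fin 4 → L} (hs : IsFamily s) {σ : Fin 4 → Fin 4}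
    (hσ : Function.Injective σ) : IsFamily fun i j => s (σ i) (σ j) where
  symm _ _ := hs.symm _ _
  three _ _ _ hij hil hjl := hs.three _ _ _ (hσ.ne hij) (hσ.ne hil) (hσ.ne hjl)
  four _ _ _ _ hij hil him hjl hjm hlm := hs.four _ _ _ _ (hσ.ne hij) (hσ.ne hil) (hσ.ne him)
    (hσ.ne hjl) (hσ.ne hjm) (hσ.ne hlm)

/-- Up to the symmetries of the relations, there are twelve relations with three indices and three
with four indices. -/
theorem isFamily_of_relations {a b c d e f : L}
    (h1 : ⁅a + b, d⁆ = 0) (h2 : ⁅a + d, b⁆ = 0) (h3 : ⁅b + d, a⁆ = 0)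
    (h4 : ⁅a + c, e⁆ = 0) (h5 : ⁅a + e, c⁆ = 0) (h6 : ⁅c + e, a⁆ = 0)
    (h7 : ⁅b + c, f⁆ = 0) (h8 : ⁅b + f, c⁆ = 0) (h9 : ⁅c + f, b⁆ = 0)
    (h10 : ⁅d + e, f⁆ = 0) (h11 : ⁅d + f, e⁆ = 0) (h12 : ⁅e + f, d⁆ = 0)
    (h13 : ⁅a, f⁆ = 0) (h14 : ⁅b, e⁆ = 0) (h15 : ⁅c, d⁆ = 0) :
    IsFamily ![![0, a, b, c], ![a, 0, d, e], ![b, d, 0, f], ![c, e, f, 0]] where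
  symm i j := by fin_cases i <;> fin_cases j <;> rfl
  three i j l hij hil hjl := by
    fin_cases i <;> fin_cases j <;> (try exact absurd rfl hij) <;>
    fin_cases l <;> first | exact absurd rfl hil | exact absurd rfl hjl | assumption |
      (rw [add_comm]; assumption)
  four i j l m hij hil him hjl hjm hlm := by
    have h13' : ⁅f, a⁆ = 0 := by rw [← lie_skew, h13, neg_zero]
    have h14' : ⁅e, b⁆ = 0 := by rw [← lie_skew, h14, neg_zero]
    have h15' : ⁅d, c⁆ = 0 := by rw [← lie_skew, h15, neg_zero]
    fin_cases i <;> fin_cases j <;> (try exact absurd rfl hij) <;>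
    fin_cases l <;> (try first | exact absurd rfl hil | exact absurd rfl hjl) <;>
    fin_cases m <;> first | exact absurd rfl him | exact absurd rfl hjm | exact absurd rfl hlm |
      assumption

/-- If `a + b + c = 0`, the three pairings of four strands can be sent to `a`, `b` and `c`. -/
theorem isFamily_of_add_eq_zero {a b c : L} (h : a + b + c = 0) :
    IsFamily ![![0, a, c, b], ![a, 0, b, c], ![c, b, 0, a], ![b, c, a, 0]] := by
  have hz : ∀ {p q r : L}, p + q + r = 0 → ⁅p + q, r⁆ = 0 := fun e => by
    rw [eq_neg_of_add_eq_zero_left e, neg_lie, lie_self, neg_zero]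
  refine isFamily_of_relations (hz ?_) (hz ?_) (hz ?_) (hz ?_) (hz ?_) (hz ?_) (hz ?_) (hz ?_)
    (hz ?_) (hz ?_) (hz ?_) (hz ?_) (lie_self a) (lie_self c) (lie_self b) <;>
  first | exact h | (rw [← h]; abel)

/-- The morphism `𝔱₄ → L` defined by a family that satisfies the relations of `𝔱₄`. -/
noncomputable def IsFamily.lift {s : Fin 4 → Fin 4 → L} (hs : IsFamily s) : T k 4 →ₗ⁅k⁆ L :=
  let φ : FreeLieAlgebra k (Gen 4) →ₗ⁅k⁆ L := FreeLieAlgebra.lift k fun p => s p.1.1 p.1.2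
  have hφ : ∀ {i j : Fin 4}, i ≠ j → φ (gen k i j) = s i j := fun h => by simp [φ, gen, h]
  have hle : relIdeal k 4 ≤ φ.ker := by
    refine LieSubmodule.lieSpan_le.2 fun x hx => (LieHom.mem_ker (f := φ)).2 ?_
    induction hx with
    | symm i j hij => rw [map_sub, hφ hij, hφ hij.symm, hs.symm, sub_self]
    | three i j l hij hil hjl =>
      rw [LieHom.map_lie, map_add, hφ hij, hφ hil, hφ hjl, hs.three i j l hij hil hjl]
    | four i j l m hij hil him hjl hjm hlm =>
      rw [LieHom.map_lie, hφ hij, hφ hlm, hs.four i j l m hij hil him hjl hjm hlm]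
  { toLinearMap := (relIdeal k 4).toSubmodule.liftQ (φ : FreeLieAlgebra k (Gen 4) →ₗ[k] L)
      fun _ hx => LinearMap.mem_ker.2 ((LieHom.mem_ker (f := φ)).1 (hle hx))
    map_lie' := by
      intro x y
      obtain ⟨x, rfl⟩ := Submodule.Quotient.mk_surjective _ x
      obtain ⟨y, rfl⟩ := Submodule.Quotient.mk_surjective _ y
      exact LieHom.map_lie φ x y }

theorem IsFamily.lift_t {s : Fin 4 → Fin 4 → L} (hs : IsFamily s) {i j : Fin 4} (h : i ≠ j) :
    hs.lift (t k i j) = s i j := by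
  change FreeLieAlgebra.lift k (fun p : Gen 4 => s p.1.1 p.1.2) (gen k i j) = s i j
  simp [gen, h]

end DK

namespace GRT

variable {k : Type*} [Field k] {L : Type*} [LieRing L] [LieAlgebra k L]

/-- The pentagon relation holds for every family that satisfies the relations of `𝔱₄`. -/
theorem Pentagon.subst_eq {ψ : F2 k} (h : Pentagon ψ) {s : Fin 4 → Fin 4 → L}
    (hs : DK.IsFamily s) :
    F2.subst (s 0 2 + s 1 2) (s 2 3) ψ - F2.subst (s 0 1 + s 0 2) (s 1 3 + s 2 3) ψ
        + F2.subst (s 0 1) (s 1 2 + s 1 3) ψ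
      = F2.subst (s 1 2) (s 2 3) ψ + F2.subst (s 0 1) (s 1 2) ψ := by
  have h' := congrArg (hs.lift (k := k)) h
  simp only [map_add, map_sub, DK.ofF2, F2.map_subst] at h'
  rw [DK.d_t _ _ (by decide), DK.d_t _ _ (by decide), DK.d_t _ _ (by decide),
    DK.d_t _ _ (by decide), DK.d_t _ _ (by decide), DK.d_t _ _ (by decide),
    DK.d_t _ _ (by decide), DK.d_t _ _ (by decide), DK.d_t _ _ (by decide),
    DK.d_t _ _ (by decide)] at h'
  simpa [hs.lift_t] using h'

/-- The pentagon relation implies the duality relation: apply it in `𝔣₂` to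
`t₀₁, t₂₃ ↦ A`, `t₁₂, t₀₃ ↦ B`, `t₀₂, t₁₃ ↦ -A - B`. -/
theorem Pentagon.duality {ψ : F2 k} (h : Pentagon ψ) (hψ : ψ ∈ F2.P k) : Duality ψ := by
  obtain ⟨C, hC⟩ : ∃ C, F2.A k + F2.B k + C = 0 := ⟨_, add_neg_cancel _⟩
  have key := h.subst_eq (DK.isFamily_of_add_eq_zero hC)
  have hBC : F2.B k + C = -F2.A k := eq_neg_of_add_eq_zero_left (by rw [← hC]; abel)
  have h1 : F2.subst (C + F2.B k) (F2.A k) ψ = 0 :=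
    F2.subst_eq_zero_of_lie_eq_zero (by rw [add_comm, hBC, neg_lie, lie_self, neg_zero]) hψ
  have h2 : F2.subst (F2.A k + C) (C + F2.A k) ψ = 0 :=
    F2.subst_eq_zero_of_lie_eq_zero (by rw [add_comm C, lie_self]) hψ
  have h3 : F2.subst (F2.A k) (F2.B k + C) ψ = 0 :=
    F2.subst_eq_zero_of_lie_eq_zero (by rw [hBC, lie_neg, lie_self, neg_zero]) hψ
  change F2.subst (C + F2.B k) (F2.A k) ψ - F2.subst (F2.A k + C) (C + F2.A k) ψ
      + F2.subst (F2.A k) (F2.B k + C) ψ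
    = F2.subst (F2.B k) (F2.A k) ψ + F2.subst (F2.A k) (F2.B k) ψ at key
  rw [h1, h2, h3, F2.subst_A_B, sub_zero, add_zero] at key
  exact eq_neg_of_add_eq_zero_left key.symm

end GRT

/-! ### The infinitesimal Gassner representation of `𝔱₄` -/

namespace DK

attribute [local instance] LieRing.ofAssociativeRing

section

variable {S : Type*} [CommRing S]

/-- The infinitesimal Gassner representation of `𝔱₄`, extended by the translations. Vectors of `S³`
are written with a fourth coordinate `1`, so that affine maps become matrices whose last row is
zero. With `(x₁, x₂, x₃) = (x, y, z)`, the generator `t₀ᵢ` is `v ↦ xᵢ v + eᵢ`; for `1 ≤ i < j`, the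
generator `tᵢⱼ` sends `eᵢ` to `xᵢ eⱼ - xⱼ eᵢ`, `eⱼ` to `xⱼ eᵢ - xᵢ eⱼ`, and kills the third basis
vector. -/
def gassner (x y z : S) : Fin 4 → Fin 4 → Matrix (Fin 4) (Fin 4) S :=
  ![![0, !![x, 0, 0, 1; 0, x, 0, 0; 0, 0, x, 0; 0, 0, 0, 0],
      !![y, 0, 0, 0; 0, y, 0, 1; 0, 0, y, 0; 0, 0, 0, 0],
      !![z, 0, 0, 0; 0, z, 0, 0; 0, 0, z, 1; 0, 0, 0, 0]],
    ![!![x, 0, 0, 1; 0, x, 0, 0; 0, 0, x, 0; 0, 0, 0, 0], 0,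
      !![-y, y, 0, 0; x, -x, 0, 0; 0, 0, 0, 0; 0, 0, 0, 0],
      !![-z, 0, z, 0; 0, 0, 0, 0; x, 0, -x, 0; 0, 0, 0, 0]],
    ![!![y, 0, 0, 0; 0, y, 0, 1; 0, 0, y, 0; 0, 0, 0, 0],
      !![-y, y, 0, 0; x, -x, 0, 0; 0, 0, 0, 0; 0, 0, 0, 0], 0,
      !![0, 0, 0, 0; 0, -z, z, 0; 0, y, -y, 0; 0, 0, 0, 0]],
    ![!![z, 0, 0, 0; 0, z, 0, 0; 0, 0, z, 1; 0, 0, 0, 0],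
      !![-z, 0, z, 0; 0, 0, 0, 0; x, 0, -x, 0; 0, 0, 0, 0],
      !![0, 0, 0, 0; 0, -z, z, 0; 0, y, -y, 0; 0, 0, 0, 0], 0]]

set_option maxHeartbeats 1000000 in
theorem isFamily_gassner (x y z : S) : IsFamily (gassner x y z) := by
  refine isFamily_of_relations ?_ ?_ ?_ ?_ ?_ ?_ ?_ ?_ ?_ ?_ ?_ ?_ ?_ ?_ ?_ <;>
  · rw [Ring.lie_def, ← Matrix.ext_iff]
    simp [Fin.forall_fin_succ]
    (try constructorm* _ ∧ _) <;> ring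

end

section

variable {k S : Type u} [Field k] [CommRing S] [Algebra k S]

/-- The matrix of the translation by `(a, b, c)`. -/
def translation (a b c : S) : Matrix (Fin 4) (Fin 4) S :=
  !![0, 0, 0, a; 0, 0, 0, b; 0, 0, 0, c; 0, 0, 0, 0]

variable {ψ : F2 k} {q : F2.Poly k}

open MvPolynomial (aeval)

set_option maxHeartbeats 1000000 in
/-- The values of `ψ` that occur in the pentagon relations are translations, except
`ψ(t₁₂, t₂₃)` and the terms commuting with some `t₀ᵢ`. -/
theorem subst_gassner (hq : F2.IsMetabValue ψ q) (x y z : S) :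
    let s := gassner x y z
    F2.subst (s 0 1 + s 0 2) (s 1 3 + s 2 3) ψ
      = aeval ![x + y, -x - y - z] q • translation z z (-x - y) ∧
    F2.subst (s 0 1) (s 1 2 + s 1 3) ψ
      = aeval ![x, -x - y - z] q • translation (y + z) (-x) (-x) ∧
    F2.subst (s 0 1) (s 1 2) ψ = aeval ![x, -x - y] q • translation y (-x) 0 ∧
    F2.subst (s 0 1) (s 0 2 + s 0 3) ψ = aeval ![x, y + z] q • translation (-y - z) x x ∧
    F2.subst (s 0 2) (s 2 3) ψ = aeval ![y, -y - z] q • translation 0 z (-y) ∧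
    F2.subst (s 0 1) (s 0 2) ψ = aeval ![x, y] q • translation (-y) x 0 ∧
    F2.subst (s 1 3 + s 2 3) (s 0 3) ψ
      = aeval ![-x - y - z, z] q • translation z z (-x - y) ∧
    F2.subst (s 1 2 + s 1 3) (s 0 2 + s 0 3) ψ
      = aeval ![-x - y - z, y + z] q • translation (y + z) (-x) (-x) ∧
    F2.subst (s 2 3) (s 0 3) ψ = aeval ![-y - z, z] q • translation 0 z (-y) := by
  intro s
  refine ⟨hq.subst_eq_smul ?_ ?_ ?_, hq.subst_eq_smul ?_ ?_ ?_, hq.subst_eq_smul ?_ ?_ ?_,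
    hq.subst_eq_smul ?_ ?_ ?_, hq.subst_eq_smul ?_ ?_ ?_, hq.subst_eq_smul ?_ ?_ ?_,
    hq.subst_eq_smul ?_ ?_ ?_, hq.subst_eq_smul ?_ ?_ ?_, hq.subst_eq_smul ?_ ?_ ?_⟩ <;>
  · rw [Ring.lie_def, ← Matrix.ext_iff]
    simp [s, gassner, translation, Fin.forall_fin_succ] <;> (try constructorm* _ ∧ _) <;> ring

end

end DK

/-! ### Consequences of the pentagon relation -/

namespace GRT

section

variable {k : Type*} [Field k] {L : Type*} [LieRing L] [LieAlgebra k L] {ψ : F2 k}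
  {s : Fin 4 → Fin 4 → L}

/-- The pentagon relation for the strands `0, 1, 2, 3`, bracketed with `t₀₁`: the term
`ψ(t₀₂ + t₁₂, t₂₃)` drops out. -/
theorem Pentagon.lie_subst_left (h : Pentagon ψ) (hs : DK.IsFamily s) :
    ⁅F2.subst (s 1 2) (s 2 3) ψ, s 0 1⁆ = ⁅F2.subst (s 0 1) (s 1 2 + s 1 3) ψ
      - F2.subst (s 0 1 + s 0 2) (s 1 3 + s 2 3) ψ - F2.subst (s 0 1) (s 1 2) ψ, s 0 1⁆ := by
  have hc : ⁅F2.subst (s 0 2 + s 1 2) (s 2 3) ψ, s 0 1⁆ = 0 := by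
    refine F2.lie_subst_eq_zero ?_ (hs.four 2 3 0 1 ?_ ?_ ?_ ?_ ?_ ?_) ψ <;> try decide
    rw [hs.symm 0 2, hs.symm 1 2]
    exact hs.three 2 0 1 (by decide) (by decide) (by decide)
  rw [eq_sub_of_add_eq (h.subst_eq hs).symm]
  simp only [sub_lie, add_lie, hc]
  abel

/-- The pentagon relations for the strands `0, 1, 2, 3` and `1, 0, 2, 3`, bracketed with `t₀₂`: they
share the term `ψ(t₀₂ + t₁₂, t₂₃)`, which is eliminated, and `ψ(t₀₁ + t₁₂, t₀₃ + t₂₃)` drops out. -/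
theorem Pentagon.lie_subst_middle (h : Pentagon ψ) (hs : DK.IsFamily s) :
    ⁅F2.subst (s 1 2) (s 2 3) ψ, s 0 2⁆ = ⁅F2.subst (s 0 2) (s 2 3) ψ + F2.subst (s 0 1) (s 0 2) ψ
      - F2.subst (s 0 1) (s 0 2 + s 0 3) ψ + F2.subst (s 0 1) (s 1 2 + s 1 3) ψ
      - F2.subst (s 0 1 + s 0 2) (s 1 3 + s 2 3) ψ - F2.subst (s 0 1) (s 1 2) ψ, s 0 2⁆ := by
  have hc : ⁅F2.subst (s 0 1 + s 1 2) (s 0 3 + s 2 3) ψ, s 0 2⁆ = 0 := by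
    refine F2.lie_subst_eq_zero ?_ ?_ ψ
    · rw [hs.symm 0 1]
      exact hs.three 1 0 2 (by decide) (by decide) (by decide)
    · rw [hs.symm 0 3, hs.symm 2 3]
      exact hs.three 3 0 2 (by decide) (by decide) (by decide)
  have h' : F2.subst (s 1 2 + s 0 2) (s 2 3) ψ - F2.subst (s 1 0 + s 1 2) (s 0 3 + s 2 3) ψ
        + F2.subst (s 1 0) (s 0 2 + s 0 3) ψ
      = F2.subst (s 0 2) (s 2 3) ψ + F2.subst (s 1 0) (s 0 2) ψ := by
    simpa using h.subst_eq (hs.comp (σ := ![1, 0, 2, 3]) (by decide))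
  rw [hs.symm 1 0, add_comm (s 1 2)] at h'
  rw [eq_sub_of_add_eq (h.subst_eq hs).symm, eq_add_of_sub_eq (eq_sub_of_add_eq h')]
  simp only [sub_lie, add_lie, hc]
  abel

/-- The pentagon relation for the strands `1, 2, 3, 0`, bracketed with `t₀₃`: the term
`ψ(t₁₂, t₂₃ + t₀₂)` drops out. -/
theorem Pentagon.lie_subst_right (h : Pentagon ψ) (hs : DK.IsFamily s) :
    ⁅F2.subst (s 1 2) (s 2 3) ψ, s 0 3⁆ = ⁅F2.subst (s 1 3 + s 2 3) (s 0 3) ψ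
      - F2.subst (s 1 2 + s 1 3) (s 0 2 + s 0 3) ψ - F2.subst (s 2 3) (s 0 3) ψ, s 0 3⁆ := by
  have hc : ⁅F2.subst (s 1 2) (s 2 3 + s 0 2) ψ, s 0 3⁆ = 0 := by
    refine F2.lie_subst_eq_zero (hs.four 1 2 0 3 ?_ ?_ ?_ ?_ ?_ ?_) ?_ ψ <;> try decide
    rw [add_comm, hs.symm 0 2]
    exact hs.three 2 0 3 (by decide) (by decide) (by decide)
  have h' : F2.subst (s 1 3 + s 2 3) (s 3 0) ψ - F2.subst (s 1 2 + s 1 3) (s 2 0 + s 3 0) ψ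
        + F2.subst (s 1 2) (s 2 3 + s 2 0) ψ
      = F2.subst (s 2 3) (s 3 0) ψ + F2.subst (s 1 2) (s 2 3) ψ := by
    simpa using h.subst_eq (hs.comp (σ := ![1, 2, 3, 0]) (by decide))
  rw [hs.symm 3 0, hs.symm 2 0] at h'
  rw [eq_sub_of_add_eq' h'.symm]
  simp only [sub_lie, add_lie, hc]
  abel

end

section

attribute [local instance] LieRing.ofAssociativeRing

variable {k : Type u} [Field k] {S : Type u} [CommRing S] [Algebra k S]

theorem subst_apply_last_eq_zero {n : ℕ} {M M' : Matrix (Fin (n + 1)) (Fin (n + 1)) S}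
    (h : ∀ i, M i (Fin.last n) = 0) (h' : ∀ i, M' i (Fin.last n) = 0) (ψ : F2 k) (i : Fin (n + 1)) :
    F2.subst M M' ψ i (Fin.last n) = 0 := by
  induction ψ using F2.induction_on generalizing i with
  | hA => simpa using h i
  | hB => simpa using h' i
  | hadd u v hu hv => simp [hu, hv]
  | hsmul a u hu => simp [hu]
  | hlie u v hu hv => simp [LieHom.map_lie, Ring.lie_def, Matrix.mul_apply, hu, hv]

theorem trace_subst_eq_zero {n : ℕ} (M M' : Matrix (Fin n) (Fin n) S) {ψ : F2 k}
    (hψ : ψ ∈ F2.P k) : (F2.subst M M' ψ).trace = 0 := by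
  refine F2.P_induction_on hψ (fun u v => ?_) (fun u v hu hv => ?_) (fun a u hu => ?_)
  · rw [LieHom.map_lie, Ring.lie_def, Matrix.trace_sub, Matrix.trace_mul_comm, sub_self]
  · rw [map_add, Matrix.trace_add, hu, hv, add_zero]
  · rw [map_smul, Matrix.trace_smul, hu, smul_zero]

open MvPolynomial (aeval)

variable {ψ : F2 k} {q : F2.Poly k}

/-- The vanishing of the trace of `ψ(t₁₂, t₂₃)` in the Gassner representation, with the diagonal
entries computed through the pentagon relations. -/
theorem Pentagon.trace_eq_zero (h : Pentagon ψ) (hψ : ψ ∈ F2.P k) (hq : F2.IsMetabValue ψ q)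
    (x y z : S) :
    x * (-z * aeval ![x + y, -x - y - z] q + (y + z) * aeval ![x, -x - y - z] q
        - y * aeval ![x, -x - y] q)
      + y * (-x * aeval ![x, y + z] q + z * aeval ![y, -y - z] q + x * aeval ![x, y] q
        - z * aeval ![x + y, -x - y - z] q - x * aeval ![x, -x - y - z] q
        + x * aeval ![x, -x - y] q)
      + z * (-(x + y) * aeval ![-x - y - z, z] q + x * aeval ![-x - y - z, y + z] q
        + y * aeval ![-y - z, z] q) = 0 := by
  have hs := DK.isFamily_gassner x y z
  obtain ⟨h1, h2, h3, h4, h5, h6, h7, h8, h9⟩ := DK.subst_gassner hq x y z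
  have hl := h.lie_subst_left hs
  have hm := h.lie_subst_middle hs
  have hr := h.lie_subst_right hs
  rw [h1, h2, h3] at hl
  rw [h1, h2, h3, h4, h5, h6] at hm
  rw [h7, h8, h9] at hr
  have htr := trace_subst_eq_zero (DK.gassner x y z 1 2) (DK.gassner x y z 2 3) hψ
  have h0 : ∀ i, F2.subst (DK.gassner x y z 1 2) (DK.gassner x y z 2 3) ψ i 3 = 0 :=
    subst_apply_last_eq_zero (n := 3) (fun i => by fin_cases i <;> rfl)
      (fun i => by fin_cases i <;> rfl) ψ
  set N := F2.subst (DK.gassner x y z 1 2) (DK.gassner x y z 2 3) ψ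
  -- As the last column of `N` vanishes, the last column of `[N, t₀ᵢ]` is `N eᵢ`.
  have hl' := congrFun (congrFun hl 0) 3
  have hm' := congrFun (congrFun hm 1) 3
  have hr' := congrFun (congrFun hr 2) 3
  simp only [Ring.lie_def, Matrix.sub_apply, Matrix.mul_apply, Fin.sum_univ_four, h0]
    at hl' hm' hr'
  simp [DK.gassner, DK.translation] at hl' hm' hr'
  simp [Matrix.trace, Fin.sum_univ_four, h0] at htr
  rw [hl', hm', hr'] at htr
  linear_combination -htr

end

end GRT

/-! ### Polynomial cocycles -/

open MvPolynomial (aeval pderiv)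

namespace F2

section Polynomials

variable {k S : Type*} [Field k] [CommRing S] [Algebra k S]

theorem map_aeval_pair {S' : Type*} [CommRing S'] [Algebra k S'] (φ : S →ₐ[k] S') (a b : S)
    (q : F2.Poly k) : φ (aeval ![a, b] q) = aeval ![φ a, φ b] q := by
  rw [MvPolynomial.comp_aeval_apply]
  congr 2
  funext i
  fin_cases i <;> rfl

theorem aeval_X_pair (q : F2.Poly k) : aeval ![MvPolynomial.X 0, MvPolynomial.X 1] q = q := by
  have : (![MvPolynomial.X 0, MvPolynomial.X 1] : Fin 2 → F2.Poly k) = MvPolynomial.X := by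
    funext i
    fin_cases i <;> rfl
  rw [this, MvPolynomial.aeval_X_left_apply]

/-- The chain rule. -/
theorem derivation_aeval_pair (D : Derivation k S S) (a b : S) (f : F2.Poly k) :
    D (aeval ![a, b] f)
      = aeval ![a, b] (pderiv 0 f) * D a + aeval ![a, b] (pderiv 1 f) * D b := by
  induction f using MvPolynomial.induction_on with
  | C c => simp
  | add p q hp hq => simp only [map_add, hp, hq]; ring
  | mul_X p i hp =>
    fin_cases i <;> simp [Derivation.leibniz, hp, MvPolynomial.pderiv_X] <;> ring

/-- A homogeneous polynomial of degree `m` restricts to a multiple of `t ^ m` on the first axis. -/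
theorem exists_aeval_zero_eq {m : ℕ} {p : F2.Poly k} (hp : p.IsHomogeneous m) :
    ∃ a : k, ∀ t : S, aeval ![t, 0] p = a • t ^ m := by
  refine ⟨p.coeff (Finsupp.single 0 m), fun t => ?_⟩
  rw [MvPolynomial.aeval_def, MvPolynomial.eval₂_eq', Finset.sum_eq_single (Finsupp.single 0 m)]
  · simp [Algebra.smul_def]
  · intro d hd hne
    have hdeg := hp (MvPolynomial.mem_support_iff.1 hd)
    have h1 : d 1 ≠ 0 := by
      intro h1
      refine hne (Finsupp.ext fun i => ?_)
      rw [Finsupp.weight_apply, Finsupp.sum_fintype _ _ (by simp)] at hdeg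
      fin_cases i <;> simp_all
    simp [h1]
  · intro h
    simp [MvPolynomial.notMem_support_iff.1 h]

/-- A symmetric homogeneous polynomial 2-cocycle is a coboundary. The factor `n` comes from Euler's
identity. -/
theorem exists_smul_eq_of_cocycle {n : ℕ} (hn : n ≠ 0) {f : F2.Poly k} (hf : f.IsHomogeneous n)
    (hsymm : aeval ![MvPolynomial.X 1, MvPolynomial.X 0] f = f)
    (hcoc : ∀ x y z : MvPolynomial (Fin 3) k, aeval ![x, y] f + aeval ![x + y, z] f
      = aeval ![y, z] f + aeval ![x, y + z] f) :
    ∃ a : k, (n : k) • f = a • F2.drinfeldPoly k n := by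
  obtain ⟨m, rfl⟩ := Nat.exists_eq_succ_of_ne_zero hn
  have hf1 : (pderiv 1 f).IsHomogeneous m := by simpa using hf.pderiv (i := 1)
  obtain ⟨a, ha⟩ := exists_aeval_zero_eq (S := F2.Poly k) hf1
  -- Differentiate the cocycle identity with respect to `z`, at `z = 0`.
  have h1 : pderiv 1 f = a • ((MvPolynomial.X 0 + MvPolynomial.X 1) ^ m - MvPolynomial.X 1 ^ m) := by
    have h := congrArg (pderiv 2) (hcoc (MvPolynomial.X 0) (MvPolynomial.X 1) (MvPolynomial.X 2))
    simp only [map_add, derivation_aeval_pair, MvPolynomial.pderiv_X, Pi.single_apply] at h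
    have h' := congrArg (aeval ![(MvPolynomial.X 0 : F2.Poly k), MvPolynomial.X 1, 0]) h
    simp [map_aeval_pair, ha, aeval_X_pair, -MvPolynomial.aeval_eq_bind₁] at h'
    rw [smul_sub, h', add_sub_cancel_left]
  have h0 : pderiv 0 f = a • ((MvPolynomial.X 0 + MvPolynomial.X 1) ^ m - MvPolynomial.X 0 ^ m) := by
    conv_lhs => rw [← hsymm]
    rw [derivation_aeval_pair, h1]
    simp [add_comm, MvPolynomial.pderiv_X]
  refine ⟨a, ?_⟩
  have he := hf.sum_X_mul_pderiv
  rw [Fin.sum_univ_two, h0, h1] at he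
  rw [Nat.cast_smul_eq_nsmul, ← he, F2.drinfeldPoly]
  simp only [MvPolynomial.smul_eq_C_mul, Nat.succ_eq_add_one, pow_succ]
  ring

end Polynomials

end F2

/-! ### The polynomial of a solution -/

namespace F2

variable {k : Type u} [Field k] {ψ : F2 k} {q : Poly k}

theorem IsMetabValue.snd_subst (hq : IsMetabValue ψ q) (y z : Metab k) :
    Metab.snd k (subst y z ψ) = aeval ![Metab.fst k y, Metab.fst k z] q
      * (Metab.fst k y * Metab.snd k z - Metab.fst k z * Metab.snd k y) := by
  let ι : Poly k →ₗ[k] Metab k := LinearMap.inr k (Poly k) (Poly k) ∘ₗ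
    LinearMap.mulRight k (Metab.fst k y * Metab.snd k z - Metab.fst k z * Metab.snd k y)
  have h1 (s) : Metab.fst k (ι s) = 0 := rfl
  have h2 (s) : Metab.snd k (ι s)
    = s * (Metab.fst k y * Metab.snd k z - Metab.fst k z * Metab.snd k y) := rfl
  have h : IsMetabPair ι (Metab.fst k y) (Metab.fst k z) y z :=
    { lie_eq := Metab.ext' (by simp [h1]) (by simp [h2])
      lie_left := fun s => Metab.ext' (by simp [h1]) (by simp [h1, h2, mul_assoc])
      lie_right := fun s => Metab.ext' (by simp [h1]) (by simp [h1, h2, mul_assoc])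
      lie_lie := fun s t => Metab.ext' (by simp) (by simp [h1]) }
  rw [hq h, h2]

/-- The map that induces `i` sends `ψ` to `Ā B̄ q`. -/
theorem IsMetabValue.snd_rho (hq : IsMetabValue ψ q) :
    Metab.snd k (rho k ψ) = MvPolynomial.X 0 * MvPolynomial.X 1 * q := by
  have h := hq.snd_subst (rho k (A k)) (rho k (B k))
  rw [← map_subst, fst_rho_A, fst_rho_B, snd_rho_A, snd_rho_B, subst_A_B, aeval_X_pair] at h
  rw [h]; ring

theorem X_mul_X_ne_zero : (MvPolynomial.X 0 * MvPolynomial.X 1 : Poly k) ≠ 0 :=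
  mul_ne_zero (MvPolynomial.X_ne_zero _) (MvPolynomial.X_ne_zero _)

theorem IsMetabValue.symm_of_duality (hq : IsMetabValue ψ q) (h : GRT.Duality ψ) :
    aeval ![MvPolynomial.X 1, MvPolynomial.X 0] q = q := by
  have h' := congrArg (fun x => Metab.snd k (rho k x)) h
  simp only [map_neg, map_subst, hq.snd_rho, hq.snd_subst, fst_rho_A, fst_rho_B, snd_rho_A,
    snd_rho_B] at h'
  refine mul_left_cancel₀ (X_mul_X_ne_zero (k := k)) ?_
  linear_combination -h'

theorem IsMetabValue.add_add_eq_zero_of_hexagon (hq : IsMetabValue ψ q) (h : GRT.Hexagon ψ) :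
    q + aeval ![MvPolynomial.X 1, -MvPolynomial.X 0 - MvPolynomial.X 1] q
      + aeval ![-MvPolynomial.X 0 - MvPolynomial.X 1, MvPolynomial.X 0] q = 0 := by
  have h' := congrArg (fun x => Metab.snd k (rho k x)) h
  simp only [map_neg, map_add, map_sub, map_zero, map_subst, hq.snd_rho, hq.snd_subst, fst_rho_A,
    fst_rho_B, snd_rho_A, snd_rho_B] at h'
  refine mul_left_cancel₀ (X_mul_X_ne_zero (k := k)) ?_
  linear_combination h'

end F2

namespace GRT

variable {k : Type u} [Field k] {ψ : F2 k} {q : F2.Poly k}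

section

variable {S : Type u} [CommRing S] [Algebra k S]

theorem Duality.aeval_comm (h : Duality ψ) (hq : F2.IsMetabValue ψ q) (a b : S) :
    aeval ![b, a] q = aeval ![a, b] q := by
  have := congrArg (aeval ![a, b]) (hq.symm_of_duality h)
  simpa only [F2.map_aeval_pair, MvPolynomial.aeval_X, Matrix.cons_val_zero, Matrix.cons_val_one]
    using this

theorem Hexagon.aeval_add_add (h : Hexagon ψ) (hq : F2.IsMetabValue ψ q) {a b c : S}
    (hc : c = -a - b) : aeval ![a, b] q + aeval ![b, c] q + aeval ![c, a] q = 0 := by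
  have := congrArg (aeval ![a, b]) (hq.add_add_eq_zero_of_hexagon h)
  rw [hc]
  simpa only [map_add, map_sub, map_neg, map_zero, F2.map_aeval_pair, MvPolynomial.aeval_X,
    Matrix.cons_val_zero, Matrix.cons_val_one] using this

theorem Pentagon.cocycle (hp : Pentagon ψ) (hh : Hexagon ψ) (hψ : ψ ∈ F2.P k)
    (hq : F2.IsMetabValue ψ q) (x y z : S) :
    x * y * aeval ![x, y] q + (x + y) * z * aeval ![x + y, z] q
      = y * z * aeval ![y, z] q + x * (y + z) * aeval ![x, y + z] q := by
  have hc := (hp.duality hψ).aeval_comm hq (S := S)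
  have h0 := hp.trace_eq_zero hψ hq x y z
  have h1 := hh.aeval_add_add hq (a := x) (b := y + z) (c := -x - y - z) (by ring)
  have h2 := hh.aeval_add_add hq (a := x + y) (b := z) (c := -x - y - z) (by ring)
  have h3 := hh.aeval_add_add hq (a := y) (b := z) (c := -y - z) (by ring)
  rw [hc x (-x - y - z)] at h1
  rw [hc (x + y) (-x - y - z)] at h2
  rw [hc y (-y - z)] at h3
  rw [hc (y + z) (-x - y - z), hc z (-x - y - z), hc z (-y - z)] at h0
  linear_combination h0 - x * z * h1 + (x + y) * z * h2 - y * z * h3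

end

/-- The pentagon relation in the abelian Lie algebra `k`, for `t₀₁ ↦ 1` and for `t₂₃ ↦ 1` with the
other generators sent to `0`, determines the coefficients of `A` and `B`. -/
theorem eq_zero_of_mem_homogeneous_one (h : ψ ∈ F2.homogeneous k 1) (hp : Pentagon ψ) : ψ = 0 := by
  let _ := LieRing.ofAssociativeRing (A := k)
  obtain ⟨α, β, rfl⟩ := F2.exists_eq_of_mem_homogeneous_one h
  have hs (a f : k) := hp.subst_eq (L := k) (DK.isFamily_of_relations (a := a) (b := 0) (c := 0)
    (d := 0) (e := 0) (f := f) (by simp) (by simp) (by simp) (by simp) (by simp) (by simp)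
    (by simp) (by simp) (by simp) (by simp) (by simp) (by simp)
    (by rw [Ring.lie_def, mul_comm, sub_self]) (by simp) (by simp))
  have h1 := hs 1 0
  have h2 := hs 0 1
  simp at h1 h2
  simp [← h1, ← h2]

variable [CharZero k]

/-- The metabelian class of a homogeneous solution of the hexagon and pentagon relations. -/
theorem exists_snd_rho_eq_smul {n : ℕ} (hn : 2 ≤ n) (hdeg : ψ ∈ F2.homogeneous k n)
    (hh : Hexagon ψ) (hp : Pentagon ψ) :
    ∃ c : k, F2.Metab.snd k (F2.rho k ψ) = c • F2.drinfeldPoly k n ∧ (Even n → c = 0) := by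
  have hψ := F2.mem_P_of_mem_homogeneous hn hdeg
  obtain ⟨q, hq⟩ := F2.exists_isMetabValue hψ
  have hf := F2.isHomogeneous_snd_rho hdeg
  rw [hq.snd_rho] at hf
  have hF {S : Type u} [CommRing S] [Algebra k S] (a b : S) :
      aeval ![a, b] (MvPolynomial.X 0 * MvPolynomial.X 1 * q) = a * b * aeval ![a, b] q := by
    simp
  have hn0 : (n : k) ≠ 0 := Nat.cast_ne_zero.2 (by omega)
  obtain ⟨a, ha⟩ := F2.exists_smul_eq_of_cocycle (by omega) hf
    (by rw [hF, hq.symm_of_duality (hp.duality hψ)]; ring)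
    (fun x y z => by simp only [hF]; exact hp.cocycle hh hψ hq x y z)
  refine ⟨(n : k)⁻¹ * a, ?_, fun he => ?_⟩
  · rw [hq.snd_rho, mul_smul, ← ha, inv_smul_smul₀ hn0]
  -- For even `n`, the hexagon relation at `(1, 1, -2)` gives `2 (2 ^ n - 1) a = 0`.
  · have hval (x y : k) : (n : k) * (x * y * aeval ![x, y] q)
        = a * ((x + y) ^ n - x ^ n - y ^ n) := by
      have := congrArg (aeval ![x, y]) ha
      simpa only [map_smul, hF, F2.drinfeldPoly, map_sub, map_pow, map_add, MvPolynomial.aeval_X,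
        Matrix.cons_val_zero, Matrix.cons_val_one, smul_eq_mul] using this
    have h1 := hval 1 1
    have h2 := hval 1 (-2)
    have h3 := hh.aeval_add_add hq (a := (1 : k)) (b := 1) (c := -2) (by norm_num)
    rw [(hp.duality hψ).aeval_comm hq (1 : k) (-2)] at h3
    rw [show (1 : k) + -2 = -1 by norm_num, he.neg_one_pow, he.neg_pow] at h2
    simp only [one_pow] at h1 h2
    have h4 : a * (2 * (2 ^ n - 1)) = 0 := by
      rw [show (1 : k) + 1 = 2 by norm_num] at h1
      linear_combination -h1 + h2 + (n : k) * h3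
    have h5 : (2 : k) ^ n - 1 ≠ 0 := by
      rw [sub_ne_zero]
      exact_mod_cast (Nat.one_lt_two_pow (by omega : n ≠ 0)).ne'
    rcases mul_eq_zero.1 h4 with h | h
    · rw [h, mul_zero]
    · exact absurd h (mul_ne_zero two_ne_zero h5)

end GRT

theorem theorem1 {k : Type*} [Field k] [CharZero k] (n : ℕ) (ψ : F2 k)
    (hdeg : ψ ∈ F2.homogeneous k n) (hhex : GRT.Hexagon ψ) (hpent : GRT.Pentagon ψ) :
    ∃ hψ : ψ ∈ F2.P k,
      (Odd n ∧ 3 ≤ n → ∃ c : k,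
        ((F2.i k (F2.cls k ⟨ψ, hψ⟩) : F2.idealAB k) : F2.Poly k) = c • F2.drinfeldPoly k n ∧
        ∀ σ : F2.P k, (σ : F2 k) ∈ GRT.grt1 k →
          ((F2.i k (F2.cls k σ) : F2.idealAB k) : F2.Poly k) = F2.drinfeldPoly k n →
          F2.cls k ⟨ψ, hψ⟩ = c • F2.cls k σ) ∧
      (¬(Odd n ∧ 3 ≤ n) → F2.cls k ⟨ψ, hψ⟩ = 0) := by
  by_cases hn : 2 ≤ n
  · obtain ⟨c, hc, hc0⟩ := GRT.exists_snd_rho_eq_smul hn hdeg hhex hpent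
    refine ⟨F2.mem_P_of_mem_homogeneous hn hdeg, fun _ => ⟨c, hc, fun σ _ hσ => ?_⟩, fun h => ?_⟩
    · refine F2.iLin_injective (hc.trans ?_)
      rw [map_smul, ← hσ]
      rfl
    · have he : Even n := Nat.not_odd_iff_even.1 fun ho => h ⟨ho, by
        obtain ⟨m, rfl⟩ := ho
        omega⟩
      refine F2.iLin_injective (hc.trans ?_)
      rw [hc0 he, zero_smul, map_zero]
  · have hψ0 : ψ = 0 := by
      interval_cases n
      · exact F2.eq_zero_of_mem_homogeneous_zero hdeg
      · exact GRT.eq_zero_of_mem_homogeneous_one hdeg hpent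
    subst hψ0
    exact ⟨zero_mem _, fun h => absurd h.2 (by omega), fun _ => map_zero (F2.cls k)⟩
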